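/- Let $\mathbb T$ be the unit circle with normalized arc length measure, let $H^2\subset L^2(\mathbb T)$ be the Hardy space of the unit disk $\mathbb D$ (identified, through boundary values, with the functions in $L^2(\mathbb T)$ whose Fourier coefficients of negative index vanish), and let $H^\infty=H^2\cap L^\infty(\mathbb T)$. Write $\mathcal G H^\infty$ for the group of invertible elements of $H^\infty$, and $\mathcal G\overline{H^\infty}$ for the set of complex conjugates of its elements. An inner function is a $\theta\in H^\infty$ with $|\theta|=1$ a.e. on $\mathbb T$, and its model space is $K_\theta=\ker T_{\bar\theta}$, where $T_g\varphi=P^+(g\varphi)$ is the Toeplitz operator on $H^2$ with symbol $g\in L^\infty(\mathbb T)$ and $P^+$ is the orthogonal projection of $L^2(\mathbb T)$ onto $H^2$. For $\lambda\in\mathbb D$, $\theta(\lambda)$ is the value at $\lambda$ of the holomorphic function on $\mathbb D$ with boundary function $\theta$. For $g\in L^\infty(\mathbb T)$ and $\alpha$ inner, write $g\sim\alpha$ if $g=g_-\,\alpha\,g_+$ a.e. on $\mathbb T$ with $g_+\in\mathcal GH^\infty$ and $g_-\in\mathcal G\overline{H^\infty}$. Proposition. Let $\theta$ be a nonconstant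 inner function and let $\lambda\in\mathbb D$. Put $$B_\lambda=\frac{z-\lambda}{1-\bar\lambda z},\qquad \tilde k^\theta_\lambda=\frac{\theta-\theta(\lambda)}{z-\lambda},\qquad k^\theta_\lambda=\frac{1-\overline{\theta(\lambda)}\,\theta}{1-\bar\lambda z},$$ $$\theta_\lambda=\frac{\theta-\theta(\lambda)}{1-\overline{\theta(\lambda)}\,\theta},\qquad M_{\theta,\lambda}=\frac{1-\overline{\theta(\lambda)}\,\theta}{\sqrt{1-|\theta(\lambda)|^2}} .$$ Then $\theta_\lambda=B_\lambda\,\tilde k^\theta_\lambda/k^\theta_\lambda$ a.e. on $\mathbb T$, $\theta_\lambda$ is an inner function, $\theta\sim\theta_\lambda$, $M_{\theta,\lambda}\in\mathcal GH^\infty$, and $f\mapsto M_{\theta,\lambda}f$ is a linear isometry (for the norm of $H^2$) from $K_{\theta_\lambda}$ onto $K_\theta$. In particular $K_\theta=M_{\theta,\lambda}K_{\theta_\lambda}\cong K_{\theta_\lambda}$. -/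

import Mathlib

open MeasureTheory AddCircle Filter
open scoped ENNReal ComplexConjugate

noncomputable section

/-- The unit circle `𝕋`, written as `ℝ / ℤ` through `t ↦ exp (2 π i t)`. -/
abbrev Torus : Type := UnitAddCircle

/-- Normalized arc length measure on the unit circle. -/
abbrev arcMeasure : Measure Torus := haarAddCircle

/-- The coordinate function `z` on the unit circle, `z (t) = exp (2 π i t)`. -/
def zCoord (t : Torus) : ℂ := fourier 1 t

/-- The space `L²(𝕋)`. -/
abbrev L2T : Type := Lp ℂ 2 arcMeasure

/-- The Hardy space `H²₊ = H²(𝔻)`, identified through boundary values with the subspace of `L²(𝕋)`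
of all functions whose Fourier coefficients of negative index vanish. -/
def H2 : Submodule ℂ L2T where
  carrier := {f | ∀ n : ℤ, n < 0 → fourierCoeff f n = 0}
  zero_mem' := by
    intro n _
    rw [← fourierBasis_repr]
    simp
  add_mem' := by
    intro f g hf hg n hn
    have h1 := hf n hn
    have h2 := hg n hn
    rw [← fourierBasis_repr] at h1 h2 ⊢
    simp [h1, h2]
  smul_mem' := by
    intro c f hf n hn
    have h1 := hf n hn
    rw [← fourierBasis_repr] at h1 ⊢
    simp [h1]

theorem isClosed_H2 : IsClosed (H2 : Set L2T) := by
  have h : (H2 : Set L2T) = ⋂ n : ℤ, ⋂ _ : n < 0,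
      {f : L2T | (inner ℂ (fourierBasis (T := (1 : ℝ)) n) f : ℂ) = 0} := by
    ext f
    simp only [Set.mem_iInter, Set.mem_ofPred_eq, SetLike.mem_coe]
    refine forall_congr' fun n => forall_congr' fun _ => ?_
    rw [← HilbertBasis.repr_apply_apply, fourierBasis_repr]
  rw [h]
  refine isClosed_iInter fun n => isClosed_iInter fun _ => ?_
  exact isClosed_eq (by fun_prop) continuous_const

instance instCompleteSpaceH2 : CompleteSpace H2 := isClosed_H2.completeSpace_coe

/-- Multiplication by `g ∈ L^∞(𝕋)` as a bounded operator on `L²(𝕋)`. -/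
def mulOp (g : Torus → ℂ) (hg : MemLp g ∞ arcMeasure) : L2T →L[ℂ] L2T :=
  (ContinuousLinearMap.mul ℂ ℂ).holderL arcMeasure ∞ 2 2 (hg.toLp g)

/-- The Toeplitz operator `T_g φ = P⁺ (g φ)` on `H²`, where `g ∈ L^∞(𝕋)` and `P⁺` is the orthogonal
projection from `L²(𝕋)` onto `H²`. -/
def toeplitz (g : Torus → ℂ) (hg : MemLp g ∞ arcMeasure) : H2 →L[ℂ] H2 :=
  H2.orthogonalProjectionOnto ∘L mulOp g hg ∘L H2.subtypeL

/-- `f ∈ H^∞`: `f` is (the boundary function of) a bounded holomorphic function on the disk, i.e.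
`f ∈ L^∞(𝕋)` and the Fourier coefficients of negative index vanish. -/
def MemHInf (f : Torus → ℂ) : Prop :=
  MemLp f ∞ arcMeasure ∧ ∀ n : ℤ, n < 0 → fourierCoeff f n = 0

/-- `f ∈ 𝒢H^∞`: `f` is invertible in the algebra `H^∞`. -/
def IsUnitHInf (f : Torus → ℂ) : Prop :=
  MemHInf f ∧ ∃ k : Torus → ℂ, MemHInf k ∧ ∀ᵐ t ∂arcMeasure, f t * k t = 1

/-- Inner functions: elements of `H^∞` that are unimodular almost everywhere on `𝕋`. -/
def IsInner (θ : Torus → ℂ) : Prop :=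
  MemHInf θ ∧ ∀ᵐ t ∂arcMeasure, ‖θ t‖ = 1

theorem IsInner.memLp_conj {θ : Torus → ℂ} (hθ : IsInner θ) :
    MemLp (fun t => conj (θ t)) ∞ arcMeasure :=
  hθ.1.1.star

/-- The model space `K_θ`, the kernel of the Toeplitz operator with symbol `conj θ`. It carries the
norm of `H²`. -/
def modelSpace (θ : Torus → ℂ) (hθ : IsInner θ) : Submodule ℂ H2 :=
  (toeplitz (fun t => conj (θ t)) hθ.memLp_conj).ker

/-- The value at the point `l` of the disk of the holomorphic function with boundary function `f`:
the Taylor coefficients at `0` are the Fourier coefficients of `f` of nonnegative index. -/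
def diskValue (f : Torus → ℂ) (l : ℂ) : ℂ :=
  ∑' n : ℕ, fourierCoeff f (n : ℤ) * l ^ n

/-- Bounded factorization `g = g₋ α ^ n g₊` with `α` inner, `g₊ ∈ 𝒢H^∞` and `conj g₋ ∈ 𝒢H^∞`;
this is the relation `g ∼ α ^ n`. -/
def BoundedFactorization (g α : Torus → ℂ) (n : ℤ) : Prop :=
  IsInner α ∧ ∃ gm gp : Torus → ℂ, IsUnitHInf gp ∧ IsUnitHInf (fun t => conj (gm t)) ∧
    ∀ᵐ t ∂arcMeasure, g t = gm t * α t ^ n * gp t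

/-- The Blaschke factor `B_l = (z - l) / (1 - conj l * z)`. -/
def blaschke (l : ℂ) (t : Torus) : ℂ :=
  (zCoord t - l) / (1 - conj l * zCoord t)

/-- The function `k_l^θ = (1 - conj (θ (l)) θ) / (1 - conj l * z)`. -/
def kernelFun (θ : Torus → ℂ) (l : ℂ) (t : Torus) : ℂ :=
  (1 - conj (diskValue θ l) * θ t) / (1 - conj l * zCoord t)

/-- The function `(θ - θ (l)) / (z - l)`. -/
def conjKernelFun (θ : Torus → ℂ) (l : ℂ) (t : Torus) : ℂ :=
  (θ t - diskValue θ l) / (zCoord t - l)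

/-- The function `θ_l = (θ - θ (l)) / (1 - conj (θ (l)) θ)`. -/
def thetaShift (θ : Torus → ℂ) (l : ℂ) (t : Torus) : ℂ :=
  (θ t - diskValue θ l) / (1 - conj (diskValue θ l) * θ t)

/-- The function `M_{θ,l} = (1 - conj (θ (l)) θ) / √(1 - |θ (l)|²)`. -/
def crofootMultiplier (θ : Torus → ℂ) (l : ℂ) (t : Torus) : ℂ :=
  (1 - conj (diskValue θ l) * θ t) / (Real.sqrt (1 - ‖diskValue θ l‖ ^ 2) : ℂ)

end

/-!
Write `c = θ(l)`, `M = (1 - (conj c) θ) / √(1 - |c|²)` and `θ_l = (θ - c) / (1 - (conj c) θ)`.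

The mean of `|θ - c|²` against the Poisson kernel of the disk at `l` is `1 - |c|²`, because the
Poisson integral of `θ` at `l` is `c` and `|θ| = 1` on the circle. As `θ` is not constant, `|c| < 1`
(`IsInner.norm_diskValue_lt_one`). The geometric series then inverts `1 - (conj c) θ` in `H^∞`
(`IsInner.memHInf_inv_one_sub_const_mul`), so that `M` is a unit of `H^∞`. Since `|θ| = 1`,
`θ - c = θ conj (1 - (conj c) θ)` on the circle; hence `θ_l` is inner and
`θ = (1 - c conj θ)⁻¹ θ_l (1 - (conj c) θ)`, which is the factorization.

A function `f ∈ H²` lies in `K_θ` exactly when `θ conj f` lies in `z H²` (`mem_modelSpace_iff`).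
The relation `θ conj M = M θ_l` gives `θ conj (M f) = M (θ_l conj f)`, so multiplication by `M` maps
`K_{θ_l}` into `K_θ`; the reciprocal of `M` satisfies the symmetric relation and maps back
(`mulOp_mem_modelSpace`). For the norms, `|M|⁻²` is the Poisson kernel of the disk at `c`, evaluated
at `θ`, that is, `1 + 2 Re (k θ)` with `k = conj c / (1 - (conj c) θ) ∈ H^∞`. For `g = M f ∈ K_θ` this
gives `|f|² = |g|² + 2 Re (k θ |g|²)`, and `k θ |g|²` is the product of `k g ∈ H²` and
`θ conj g ∈ z H²`, so that it has mean zero (`integral_mul_mul_conj_eq_zero`).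

All membership statements rest on `fourierCoeff_mul_eq_zero`: one-sided Fourier spectra add under
multiplication.
-/

/-! ### The unit circle -/

section Circle

theorem norm_fourier_apply (n : ℤ) (t : Torus) : ‖fourier n t‖ = 1 := by
  rw [fourier_apply, Circle.norm_coe]

theorem norm_zCoord (t : Torus) : ‖zCoord t‖ = 1 := norm_fourier_apply 1 t

theorem fourier_natCast_eq_zCoord_pow (n : ℕ) (t : Torus) : fourier (n : ℤ) t = zCoord t ^ n := by
  induction n with
  | zero => simp
  | succ k ih => rw [Nat.cast_succ, fourier_add, ih, pow_succ, zCoord]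

theorem continuous_zCoord : Continuous zCoord := (fourier 1).continuous

/-- `1 - a w` does not vanish for `a` in the open disk and `w` on the circle. -/
theorem one_sub_mul_ne_zero {a w : ℂ} (ha : ‖a‖ < 1) (hw : ‖w‖ = 1) : 1 - a * w ≠ 0 := by
  intro h
  have h1 : ‖a * w‖ = 1 := by rw [← sub_eq_zero.1 h, norm_one]
  rw [norm_mul, hw, mul_one] at h1
  exact ha.ne h1

theorem mul_conj_eq_one {w : ℂ} (hw : ‖w‖ = 1) : w * conj w = 1 := by
  rw [Complex.mul_conj, Complex.normSq_eq_norm_sq, hw]; simp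

end Circle

/-! ### Fourier coefficients of products and series -/

section FourierCoefficients

theorem fourierCoeff_conj (f : Torus → ℂ) (n : ℤ) :
    fourierCoeff (fun t => conj (f t)) n = conj (fourierCoeff f (-n)) := by
  simp only [fourierCoeff]
  rw [← integral_conj]
  refine integral_congr_ae (Eventually.of_forall fun t => ?_)
  simp

theorem fourierCoeff_fourier_mul (f : Torus → ℂ) (m n : ℤ) :
    fourierCoeff (fun t => fourier m t * f t) n = fourierCoeff f (n - m) := by
  simp only [fourierCoeff]
  refine integral_congr_ae (Eventually.of_forall fun t => ?_)
  simp only [smul_eq_mul]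
  rw [show -(n - m) = -n + m by ring, fourier_add, mul_assoc]

theorem fourierCoeff_zero_eq_integral (f : Torus → ℂ) :
    fourierCoeff f 0 = ∫ t, f t ∂arcMeasure := by
  simp [fourierCoeff]

theorem inner_fourierBasis (f : L2T) (n : ℤ) :
    (inner ℂ (fourierBasis (T := (1 : ℝ)) n) f : ℂ) = fourierCoeff f n := by
  rw [← HilbertBasis.repr_apply_apply, fourierBasis_repr]

theorem inner_eq_integral_conj_mul (f g : L2T) :
    (inner ℂ f g : ℂ) = ∫ t, conj (f t) * g t ∂arcMeasure := by
  rw [L2.inner_def]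
  refine integral_congr_ae (Eventually.of_forall fun t => ?_)
  simp [mul_comm]

/-- Fourier spectra add under multiplication: if the spectra of `f, g ∈ L²` lie in `[a, ∞)` and
`[b, ∞)`, that of `f g` lies in `[a + b, ∞)`. By Parseval's identity, the coefficients of `f g` are
the convolution of those of `f` and `g`. -/
theorem fourierCoeff_mul_eq_zero {f g : Torus → ℂ} (hf : MemLp f 2 arcMeasure)
    (hg : MemLp g 2 arcMeasure) {a b : ℤ} (hfa : ∀ n < a, fourierCoeff f n = 0)
    (hgb : ∀ n < b, fourierCoeff g n = 0) {n : ℤ} (hn : n < a + b) :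
    fourierCoeff (fun t => f t * g t) n = 0 := by
  have hF : MemLp (fun t => conj (fourier (-n) t * f t)) 2 arcMeasure := by
    refine MemLp.star (f := fun t => fourier (-n) t * f t) ?_
    refine hf.of_le ((fourier (-n)).continuous.aestronglyMeasurable.mul hf.1) ?_
    exact Eventually.of_forall fun t => by
      rw [norm_mul, norm_fourier_apply, one_mul]
  have hcoeF := hF.coeFn_toLp
  have hcoeg := hg.coeFn_toLp
  have hinner : (inner ℂ (hF.toLp _) (hg.toLp _) : ℂ) = fourierCoeff (fun t => f t * g t) n := by
    rw [inner_eq_integral_conj_mul]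
    refine integral_congr_ae ?_
    filter_upwards [hcoeF, hcoeg] with t h1 h2
    rw [h1, h2, Complex.conj_conj, smul_eq_mul, mul_assoc]
  have hsum := (fourierBasis (T := (1 : ℝ))).hasSum_inner_mul_inner (hF.toLp _) (hg.toLp _)
  rw [hinner] at hsum
  refine hsum.unique ?_
  convert hasSum_zero using 1
  ext i
  rw [← inner_conj_symm, inner_fourierBasis, inner_fourierBasis, fourierCoeff_congr_ae hcoeF,
    fourierCoeff_congr_ae hcoeg, fourierCoeff_conj, fourierCoeff_fourier_mul]
  rcases lt_or_ge i b with hi | hi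
  · rw [hgb i hi, mul_zero]
  · rw [hfa _ (by omega)]; simp

/-- A series dominated by a convergent numerical series may be integrated termwise against an
integrable function. -/
theorem hasSum_integral_mul_of_norm_le {g : Torus → ℂ} (hg : Integrable g arcMeasure)
    {F : ℕ → Torus → ℂ} (hF : ∀ n, AEStronglyMeasurable (F n) arcMeasure) {u : ℕ → ℝ}
    (hu : Summable u) (hFu : ∀ n, ∀ᵐ t ∂arcMeasure, ‖F n t‖ ≤ u n) {S : Torus → ℂ}
    (hS : ∀ᵐ t ∂arcMeasure, HasSum (fun n => F n t) (S t)) :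
    HasSum (fun n => ∫ t, F n t * g t ∂arcMeasure) (∫ t, S t * g t ∂arcMeasure) := by
  have hint : ∀ n, Integrable (fun t => F n t * g t) arcMeasure := fun n =>
    hg.bdd_mul (hF n) (hFu n)
  have h := hasSum_integral_of_summable_integral_norm (μ := arcMeasure) (E := ℂ)
    (F := fun n t => F n t * g t) hint ?_
  · have heq : ∫ t, S t * g t ∂arcMeasure = ∫ t, ∑' n, F n t * g t ∂arcMeasure := by
      refine integral_congr_ae ?_
      filter_upwards [hS] with t ht
      exact (ht.mul_right (g t)).tsum_eq.symm
    rw [heq]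
    exact h
  · refine Summable.of_nonneg_of_le (fun n => integral_nonneg fun t => norm_nonneg _) (fun n => ?_)
      (hu.mul_right (∫ t, ‖g t‖ ∂arcMeasure))
    rw [← integral_const_mul]
    refine integral_mono_ae (hint n).norm (hg.norm.const_mul _) ?_
    filter_upwards [hFu n] with t ht
    simp only [norm_mul]
    gcongr

end FourierCoefficients

/-! ### The algebra `H^∞` -/

section HardyAlgebra

theorem MemHInf.memLp_two {f : Torus → ℂ} (hf : MemHInf f) : MemLp f 2 arcMeasure :=
  hf.1.mono_exponent le_top

theorem MemHInf.integrable {f : Torus → ℂ} (hf : MemHInf f) : Integrable f arcMeasure :=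
  hf.1.integrable le_top

theorem MemHInf.congr_ae {f g : Torus → ℂ} (hf : MemHInf f) (h : f =ᵐ[arcMeasure] g) :
    MemHInf g :=
  ⟨hf.1.ae_eq h, by rw [← fourierCoeff_congr_ae h]; exact hf.2⟩

theorem MemHInf.mul {f g : Torus → ℂ} (hf : MemHInf f) (hg : MemHInf g) :
    MemHInf (fun t => f t * g t) :=
  ⟨hg.1.mul' hf.1, fun _ hn =>
    fourierCoeff_mul_eq_zero hf.memLp_two hg.memLp_two hf.2 hg.2 (by simpa using hn)⟩

theorem memHInf_const (c : ℂ) : MemHInf (fun _ => c) := by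
  refine ⟨memLp_const c, fun n hn => ?_⟩
  have h := fourierCoeff.const_mul (fourier (T := (1 : ℝ)) 0) c n
  rw [fourierCoeff_fourier, Pi.single_eq_of_ne hn.ne, mul_zero] at h
  simpa using h

theorem MemHInf.add {f g : Torus → ℂ} (hf : MemHInf f) (hg : MemHInf g) :
    MemHInf (fun t => f t + g t) := by
  refine ⟨hf.1.add hg.1, fun n hn => ?_⟩
  have h := congrFun (fourierCoeff.add hf.integrable hg.integrable) n
  rw [Pi.add_apply, hf.2 n hn, hg.2 n hn, add_zero] at h
  exact h

theorem MemHInf.const_mul {f : Torus → ℂ} (hf : MemHInf f) (c : ℂ) :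
    MemHInf (fun t => c * f t) :=
  (memHInf_const c).mul hf

theorem MemHInf.pow {f : Torus → ℂ} (hf : MemHInf f) (n : ℕ) : MemHInf (fun t => f t ^ n) := by
  induction n with
  | zero => simpa using memHInf_const 1
  | succ k ih => simpa only [pow_succ] using ih.mul hf

theorem MemHInf.one_sub_const_mul {f : Torus → ℂ} (hf : MemHInf f) (a : ℂ) :
    MemHInf (fun t => 1 - a * f t) := by
  simpa [sub_eq_add_neg] using (memHInf_const 1).add (hf.const_mul (-a))

/-- The inverse is the uniformly convergent geometric series `∑ aⁿ θⁿ`, whose terms are in `H^∞`. -/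
theorem IsInner.memHInf_inv_one_sub_const_mul {θ : Torus → ℂ} (hθ : IsInner θ) {a : ℂ}
    (ha : ‖a‖ < 1) : MemHInf (fun t => (1 - a * θ t)⁻¹) := by
  constructor
  · refine memLp_top_of_bound
      (hθ.1.one_sub_const_mul a).1.1.aemeasurable.inv.aestronglyMeasurable (1 - ‖a‖)⁻¹ ?_
    filter_upwards [hθ.2] with t ht
    rw [norm_inv]
    refine inv_anti₀ (by linarith) ?_
    have h := norm_sub_norm_le (1 : ℂ) (a * θ t)
    rwa [norm_mul, ht, mul_one, norm_one] at h
  · intro n hn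
    have h := hasSum_integral_mul_of_norm_le (g := fun t => fourier (-n) t)
      ((fourier (-n)).continuous.integrable_of_hasCompactSupport
        (HasCompactSupport.of_compactSpace _))
      (F := fun k t => (a * θ t) ^ k) (u := fun k => ‖a‖ ^ k)
      (fun k => ((hθ.1.const_mul a).pow k).1.1)
      (summable_geometric_of_lt_one (norm_nonneg _) ha)
      (fun k => by
        filter_upwards [hθ.2] with t ht
        rw [norm_pow, norm_mul, ht, mul_one])
      (S := fun t => (1 - a * θ t)⁻¹)
      (by
        filter_upwards [hθ.2] with t ht
        exact hasSum_geometric_of_norm_lt_one (by rwa [norm_mul, ht, mul_one]))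
    have h0 : ∀ f : Torus → ℂ,
        ∫ t, f t * fourier (-n) t ∂arcMeasure = fourierCoeff f n := fun f => by
      simp only [fourierCoeff, smul_eq_mul, mul_comm]
    simp only [h0] at h
    refine h.unique ?_
    convert hasSum_zero using 1
    ext k
    exact ((hθ.1.const_mul a).pow k).2 n hn

end HardyAlgebra

/-! ### Poisson integrals and the value of an inner function at a point -/

section Poisson

/-- The Poisson kernel `(1 - |l|²) / |1 - (conj l) z|²` of the disk at the point `l`, as a function
on the circle. -/
noncomputable def poissonKernelDisk (l : ℂ) (t : Torus) : ℝ :=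
  (1 - ‖l‖ ^ 2) / Complex.normSq (1 - conj l * zCoord t)

theorem poissonKernelDisk_pos {l : ℂ} (hl : ‖l‖ < 1) (t : Torus) : 0 < poissonKernelDisk l t := by
  refine div_pos (by nlinarith [norm_nonneg l]) (Complex.normSq_pos.2 ?_)
  exact one_sub_mul_ne_zero (by simpa using hl) (norm_zCoord t)

theorem continuous_poissonKernelDisk {l : ℂ} (hl : ‖l‖ < 1) :
    Continuous (poissonKernelDisk l) := by
  refine continuous_const.div (Complex.continuous_normSq.comp
    (continuous_const.sub (continuous_const.mul continuous_zCoord))) fun t => ?_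
  exact (Complex.normSq_pos.2
    (one_sub_mul_ne_zero (by simpa using hl) (norm_zCoord t))).ne'

/-- The Poisson kernel as the sum of its antianalytic part and of its analytic part vanishing
at the origin. -/
theorem poissonKernelDisk_eq_add {l : ℂ} (hl : ‖l‖ < 1) (t : Torus) :
    (poissonKernelDisk l t : ℂ) = (1 - l * conj (zCoord t))⁻¹ +
      conj l * zCoord t * (1 - conj l * zCoord t)⁻¹ := by
  have h1 : 1 - conj l * zCoord t ≠ 0 :=
    one_sub_mul_ne_zero (by simpa using hl) (norm_zCoord t)
  have h2 : 1 - l * conj (zCoord t) ≠ 0 :=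
    one_sub_mul_ne_zero hl (by simpa using norm_zCoord t)
  have hz := mul_conj_eq_one (norm_zCoord t)
  have hl2 : ((‖l‖ : ℂ)) ^ 2 = l * conj l := by
    rw [Complex.mul_conj, Complex.normSq_eq_norm_sq]; push_cast; rfl
  rw [poissonKernelDisk]
  push_cast
  rw [← Complex.mul_conj, hl2]
  simp only [map_sub, map_one, map_mul, Complex.conj_conj]
  field_simp
  linear_combination (l * conj l) * hz

/-- The Poisson integral of a function in `H^∞` is the holomorphic function it is the boundary
function of: the antianalytic part of the kernel yields the Taylor series, and the analytic part
only meets Fourier coefficients of negative index. -/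
theorem MemHInf.integral_poissonKernelDisk_mul {g : Torus → ℂ} (hg : MemHInf g) {l : ℂ}
    (hl : ‖l‖ < 1) :
    ∫ t, (poissonKernelDisk l t : ℂ) * g t ∂arcMeasure = diskValue g l := by
  have hz : ∀ t, ‖conj l * zCoord t‖ < 1 := fun t => by
    rwa [norm_mul, norm_zCoord, mul_one, RCLike.norm_conj]
  have hz' : ∀ t, ‖l * conj (zCoord t)‖ < 1 := fun t => by
    rwa [norm_mul, RCLike.norm_conj, norm_zCoord, mul_one]
  have hcz : Continuous fun t => conj (zCoord t) := Complex.continuous_conj.comp continuous_zCoord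
  have hA := hasSum_integral_mul_of_norm_le hg.integrable
    (F := fun n t => (l * conj (zCoord t)) ^ n) (u := fun n => ‖l‖ ^ n)
    (fun n => ((continuous_const.mul hcz).pow n).aestronglyMeasurable)
    (summable_geometric_of_lt_one (norm_nonneg _) hl)
    (fun n => Eventually.of_forall fun t => by
      rw [norm_pow, norm_mul, RCLike.norm_conj, norm_zCoord, mul_one])
    (Eventually.of_forall fun t => hasSum_geometric_of_norm_lt_one (hz' t))
  have hB := hasSum_integral_mul_of_norm_le hg.integrable
    (F := fun n t => conj l * zCoord t * (conj l * zCoord t) ^ n) (u := fun n => ‖l‖ * ‖l‖ ^ n)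
    (fun n => ((continuous_const.mul continuous_zCoord).mul
      ((continuous_const.mul continuous_zCoord).pow n)).aestronglyMeasurable)
    ((summable_geometric_of_lt_one (norm_nonneg _) hl).mul_left _)
    (fun n => Eventually.of_forall fun t => by
      simp only [norm_mul, norm_pow, RCLike.norm_conj, norm_zCoord, mul_one, le_refl])
    (Eventually.of_forall fun t => (hasSum_geometric_of_norm_lt_one (hz t)).mul_left _)
  have hA' : ∀ n : ℕ, ∫ t, (l * conj (zCoord t)) ^ n * g t ∂arcMeasure =
      fourierCoeff g (n : ℤ) * l ^ n := fun n => by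
    rw [fourierCoeff, mul_comm, ← integral_const_mul]
    refine integral_congr_ae (Eventually.of_forall fun t => ?_)
    simp only [smul_eq_mul, fourier_neg, fourier_natCast_eq_zCoord_pow, map_pow]
    ring
  have hB' : ∀ n : ℕ, ∫ t, conj l * zCoord t * (conj l * zCoord t) ^ n * g t ∂arcMeasure = 0 :=
    fun n => by
      have h0 := hg.2 (-((n + 1 : ℕ) : ℤ)) (by omega)
      rw [fourierCoeff, neg_neg] at h0
      rw [← mul_zero (conj l ^ (n + 1)), ← h0, ← integral_const_mul]
      refine integral_congr_ae (Eventually.of_forall fun t => ?_)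
      simp only [smul_eq_mul, fourier_natCast_eq_zCoord_pow]
      ring
  simp only [hA'] at hA
  simp only [hB'] at hB
  have hcont : Continuous fun t => (1 - l * conj (zCoord t))⁻¹ :=
    (continuous_const.sub (continuous_const.mul hcz)).inv₀ fun t =>
      one_sub_mul_ne_zero hl (by simpa using norm_zCoord t)
  have hcont' : Continuous fun t => conj l * zCoord t * (1 - conj l * zCoord t)⁻¹ :=
    (continuous_const.mul continuous_zCoord).mul
      ((continuous_const.sub (continuous_const.mul continuous_zCoord)).inv₀ fun t =>
        one_sub_mul_ne_zero (by simpa using hl) (norm_zCoord t))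
  have hint : ∀ {F : Torus → ℂ}, Continuous F → Integrable (fun t => F t * g t) arcMeasure :=
    fun {F} hF => by
      obtain ⟨C, hC⟩ := isCompact_univ.exists_bound_of_continuousOn hF.continuousOn
      exact hg.integrable.bdd_mul hF.aestronglyMeasurable
        (Eventually.of_forall fun t => hC t (Set.mem_univ t))
  simp only [poissonKernelDisk_eq_add hl, add_mul]
  rw [integral_add (hint hcont) (hint hcont'), hB.unique hasSum_zero, add_zero]
  exact hA.tsum_eq.symm

theorem diskValue_const (c l : ℂ) : diskValue (fun _ => c) l = c := by
  have h : ∀ n : ℤ, fourierCoeff (fun _ : Torus => c) n = if n = 0 then c else 0 := fun n => by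
    have h := fourierCoeff.const_mul (fourier (T := (1 : ℝ)) 0) c n
    rw [fourierCoeff_fourier] at h
    simpa [Pi.single_apply] using h
  rw [diskValue, tsum_eq_single 0]
  · simp [h]
  · intro n hn
    simp [h, hn]

/-- A strict maximum principle: the mean of `‖θ - θ(l)‖²` with respect to the Poisson kernel
at `l` is `1 - ‖θ(l)‖²`, so that it is positive unless `θ` is constant. -/
theorem IsInner.norm_diskValue_lt_one {θ : Torus → ℂ} (hθ : IsInner θ)
    (hnc : ¬ ∃ c : ℂ, ∀ᵐ t ∂arcMeasure, θ t = c) {l : ℂ} (hl : ‖l‖ < 1) :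
    ‖diskValue θ l‖ < 1 := by
  by_contra! hge
  set c := diskValue θ l with hc
  refine hnc ⟨c, ?_⟩
  have hP := continuous_poissonKernelDisk hl
  obtain ⟨C, hC⟩ := isCompact_univ.exists_bound_of_continuousOn hP.continuousOn
  have hPc : Continuous fun t => (poissonKernelDisk l t : ℂ) := Complex.continuous_ofReal.comp hP
  have hint : ∀ {f : Torus → ℂ}, Integrable f arcMeasure →
      Integrable (fun t => (poissonKernelDisk l t : ℂ) * f t) arcMeasure := fun {f} hf =>
    hf.bdd_mul (c := C) hPc.aestronglyMeasurable (Eventually.of_forall fun t => by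
      rw [Complex.norm_real]; exact hC t (Set.mem_univ t))
  have hθP := hθ.1.integral_poissonKernelDisk_mul hl
  have h1P := (memHInf_const (1 + (‖c‖ : ℂ) ^ 2)).integral_poissonKernelDisk_mul hl
  rw [diskValue_const] at h1P
  have hθP' : ∫ t, (poissonKernelDisk l t : ℂ) * conj (θ t) ∂arcMeasure = conj c := by
    rw [hc, ← hθP, ← integral_conj]
    simp
  have hI1 := hint hθ.1.integrable
  have hI2 : Integrable (fun t => (poissonKernelDisk l t : ℂ) * conj (θ t)) arcMeasure :=
    hint (hθ.memLp_conj.integrable le_top)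
  have hI3 := hint (integrable_const (μ := arcMeasure) (1 + (‖c‖ : ℂ) ^ 2))
  have hcc : c * conj c = (‖c‖ : ℂ) ^ 2 := by
    rw [Complex.mul_conj, Complex.normSq_eq_norm_sq]; push_cast; rfl
  have hkey : (∫ t, ((poissonKernelDisk l t * ‖θ t - c‖ ^ 2 : ℝ) : ℂ) ∂arcMeasure) =
      1 - (‖c‖ : ℂ) ^ 2 := by
    have hpt : ∀ᵐ t ∂arcMeasure, ((poissonKernelDisk l t * ‖θ t - c‖ ^ 2 : ℝ) : ℂ) =
        ((poissonKernelDisk l t : ℂ) * (1 + (‖c‖ : ℂ) ^ 2) -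
          conj c * ((poissonKernelDisk l t : ℂ) * θ t)) -
          c * ((poissonKernelDisk l t : ℂ) * conj (θ t)) := by
      filter_upwards [hθ.2] with t ht
      have h1 := mul_conj_eq_one ht
      rw [← Complex.normSq_eq_norm_sq]
      push_cast
      rw [← Complex.mul_conj, map_sub]
      linear_combination (poissonKernelDisk l t : ℂ) * (h1 + hcc)
    have hI13 : Integrable (fun t => (poissonKernelDisk l t : ℂ) * (1 + (‖c‖ : ℂ) ^ 2) -
        conj c * ((poissonKernelDisk l t : ℂ) * θ t)) arcMeasure := hI3.sub (hI1.const_mul _)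
    rw [integral_congr_ae hpt, integral_sub hI13 (hI2.const_mul _),
      integral_sub hI3 (hI1.const_mul _), integral_const_mul, integral_const_mul, h1P, hθP, hθP',
      ← hc]
    linear_combination -2 * hcc
  have hkey' : ∫ t, poissonKernelDisk l t * ‖θ t - c‖ ^ 2 ∂arcMeasure = 1 - ‖c‖ ^ 2 := by
    have h := hkey
    rw [integral_complex_ofReal] at h
    exact_mod_cast h
  have hnn : 0 ≤ fun t => poissonKernelDisk l t * ‖θ t - c‖ ^ 2 := fun t =>
    mul_nonneg (poissonKernelDisk_pos hl t).le (sq_nonneg _)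
  have hzero : ∫ t, poissonKernelDisk l t * ‖θ t - c‖ ^ 2 ∂arcMeasure = 0 :=
    le_antisymm (by rw [hkey']; nlinarith) (integral_nonneg hnn)
  have hintR : Integrable (fun t => poissonKernelDisk l t * ‖θ t - c‖ ^ 2) arcMeasure := by
    have hm : MemLp (fun t => θ t - c) 2 arcMeasure := hθ.1.memLp_two.sub (memLp_const c)
    exact hm.integrable_norm_pow (by norm_num) |>.bdd_mul hP.aestronglyMeasurable
      (Eventually.of_forall fun t => hC t (Set.mem_univ t))
  filter_upwards [(integral_eq_zero_iff_of_nonneg hnn hintR).1 hzero] with t ht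
  have h := (mul_eq_zero.1 ht).resolve_left (poissonKernelDisk_pos hl t).ne'
  exact sub_eq_zero.1 (norm_eq_zero.1 (pow_eq_zero_iff two_ne_zero |>.1 h))

end Poisson

/-! ### Model spaces and their multipliers -/

section ModelSpace

theorem mem_orthogonal_H2_iff (v : L2T) : v ∈ H2ᗮ ↔ ∀ n : ℤ, 0 ≤ n → fourierCoeff v n = 0 := by
  constructor
  · intro hv n hn
    have hmem : fourierBasis (T := (1 : ℝ)) n ∈ H2 := by
      intro m hm
      rw [← inner_fourierBasis]
      exact fourierBasis.orthonormal.2 (by omega)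
    rw [← inner_fourierBasis]
    exact hv _ hmem
  · intro hv g hg
    refine ((fourierBasis (T := (1 : ℝ))).hasSum_inner_mul_inner g v).unique ?_
    convert hasSum_zero using 1
    ext i
    rw [← inner_conj_symm, inner_fourierBasis, inner_fourierBasis]
    rcases lt_or_ge i 0 with hi | hi
    · rw [hg i hi]; simp
    · rw [hv i hi, mul_zero]

theorem coeFn_mulOp {g : Torus → ℂ} (hg : MemLp g ∞ arcMeasure) (f : L2T) :
    mulOp g hg f =ᵐ[arcMeasure] fun t => g t * f t := by
  have h := (ContinuousLinearMap.mul ℂ ℂ).coeFn_holder (r := 2) (hg.toLp g) f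
  filter_upwards [h, hg.coeFn_toLp] with t h1 h2
  rw [← h2]
  exact h1

/-- `f ∈ K_θ` if and only if `θ` times the complex conjugate of `f` lies in `z H²`. -/
theorem mem_modelSpace_iff {θ : Torus → ℂ} (hθ : IsInner θ) (f : H2) :
    f ∈ modelSpace θ hθ ↔
      ∀ n : ℤ, n < 1 → fourierCoeff (fun t => θ t * conj ((f : L2T) t)) n = 0 := by
  have h : (fun t => θ t * conj ((f : L2T) t)) =ᵐ[arcMeasure]
      fun t => conj (mulOp (fun t => conj (θ t)) hθ.memLp_conj (f : L2T) t) := by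
    filter_upwards [coeFn_mulOp hθ.memLp_conj (f : L2T)] with t ht
    rw [ht, map_mul, Complex.conj_conj]
  rw [modelSpace, LinearMap.mem_ker]
  change H2.orthogonalProjectionOnto (mulOp _ hθ.memLp_conj (f : L2T)) = 0 ↔ _
  rw [Submodule.orthogonalProjectionOnto_eq_zero_iff, mem_orthogonal_H2_iff,
    fourierCoeff_congr_ae h]
  simp only [fourierCoeff_conj, map_eq_zero]
  exact ⟨fun H n hn => H _ (by omega), fun H n hn => by simpa using H (-n) (by omega)⟩

theorem mulOp_mem_H2 {M : Torus → ℂ} (hM : MemHInf M) {f : L2T} (hf : f ∈ H2) :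
    mulOp M hM.1 f ∈ H2 := by
  intro n hn
  rw [fourierCoeff_congr_ae (coeFn_mulOp hM.1 f)]
  exact fourierCoeff_mul_eq_zero hM.memLp_two (Lp.memLp f) hM.2 hf (by simpa using hn)

/-- A multiplier `M ∈ H^∞` with `θ₂ (conj M) = M θ₁` maps `K_{θ₁}` into `K_{θ₂}`, since
`θ₂ conj (M f) = M (θ₁ conj f)`. -/
theorem mulOp_mem_modelSpace {θ₁ θ₂ M : Torus → ℂ} (h₁ : IsInner θ₁) (h₂ : IsInner θ₂)
    (hM : MemHInf M) (h : ∀ᵐ t ∂arcMeasure, θ₂ t * conj (M t) = M t * θ₁ t) {f : H2}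
    (hf : f ∈ modelSpace θ₁ h₁) :
    (⟨mulOp M hM.1 f, mulOp_mem_H2 hM f.2⟩ : H2) ∈ modelSpace θ₂ h₂ := by
  rw [mem_modelSpace_iff] at hf ⊢
  intro n hn
  have hae : (fun t => θ₂ t * conj (mulOp M hM.1 (f : L2T) t)) =ᵐ[arcMeasure]
      fun t => M t * (θ₁ t * conj ((f : L2T) t)) := by
    filter_upwards [h, coeFn_mulOp hM.1 (f : L2T)] with t h1 h2
    rw [h2, map_mul, ← mul_assoc, h1, mul_assoc]
  have hmem : MemLp (fun t => θ₁ t * conj ((f : L2T) t)) 2 arcMeasure :=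
    (Lp.memLp (f : L2T)).star.mul' h₁.1.1
  rw [fourierCoeff_congr_ae hae]
  exact fourierCoeff_mul_eq_zero hM.memLp_two hmem hM.2 hf (by simpa using hn)

/-- Multiplication by `M`, as a linear map from `K_{θ₁}` to `K_{θ₂}`. -/
noncomputable def modelSpaceMul {θ₁ θ₂ M : Torus → ℂ} (h₁ : IsInner θ₁) (h₂ : IsInner θ₂)
    (hM : MemHInf M) (h : ∀ᵐ t ∂arcMeasure, θ₂ t * conj (M t) = M t * θ₁ t) :
    modelSpace θ₁ h₁ →ₗ[ℂ] modelSpace θ₂ h₂ where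
  toFun f := ⟨⟨mulOp M hM.1 (f : H2), mulOp_mem_H2 hM (f : H2).2⟩,
    mulOp_mem_modelSpace h₁ h₂ hM h f.2⟩
  map_add' f g := by
    ext1; ext1
    exact map_add (mulOp M hM.1) _ _
  map_smul' c f := by
    ext1; ext1
    exact map_smul (mulOp M hM.1) _ _

theorem coeFn_modelSpaceMul {θ₁ θ₂ M : Torus → ℂ} (h₁ : IsInner θ₁) (h₂ : IsInner θ₂)
    (hM : MemHInf M) (h : ∀ᵐ t ∂arcMeasure, θ₂ t * conj (M t) = M t * θ₁ t)
    (f : modelSpace θ₁ h₁) :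
    (((modelSpaceMul h₁ h₂ hM h f : H2) : L2T) : Torus → ℂ) =ᵐ[arcMeasure]
      fun t => M t * ((f : H2) : L2T) t :=
  coeFn_mulOp hM.1 _

theorem modelSpaceMul_modelSpaceMul {θ₁ θ₂ M N : Torus → ℂ} (h₁ : IsInner θ₁) (h₂ : IsInner θ₂)
    (hM : MemHInf M) (h : ∀ᵐ t ∂arcMeasure, θ₂ t * conj (M t) = M t * θ₁ t)
    (hN : MemHInf N) (h' : ∀ᵐ t ∂arcMeasure, θ₁ t * conj (N t) = N t * θ₂ t)
    (hNM : ∀ᵐ t ∂arcMeasure, N t * M t = 1) (f : modelSpace θ₁ h₁) :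
    modelSpaceMul h₂ h₁ hN h' (modelSpaceMul h₁ h₂ hM h f) = f := by
  ext1; ext1
  refine Lp.ext ?_
  filter_upwards [coeFn_modelSpaceMul h₂ h₁ hN h' (modelSpaceMul h₁ h₂ hM h f),
    coeFn_modelSpaceMul h₁ h₂ hM h f, hNM] with t e1 e2 e3
  rw [e1, e2, ← mul_assoc, e3, one_mul]

/-- For `g ∈ K_θ` and `k ∈ H^∞`, the function `k θ |g|²` has mean zero, as the product of
`k g ∈ H²` and `θ conj g ∈ z H²`. -/
theorem integral_mul_mul_conj_eq_zero {θ k : Torus → ℂ} (hθ : IsInner θ) (hk : MemHInf k) {g : H2}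
    (hg : g ∈ modelSpace θ hθ) :
    ∫ t, k t * (g : L2T) t * (θ t * conj ((g : L2T) t)) ∂arcMeasure = 0 := by
  rw [mem_modelSpace_iff] at hg
  rw [← fourierCoeff_zero_eq_integral]
  have hkg : MemLp (fun t => k t * (g : L2T) t) 2 arcMeasure := (Lp.memLp (g : L2T)).mul' hk.1
  have hθg : MemLp (fun t => θ t * conj ((g : L2T) t)) 2 arcMeasure :=
    (Lp.memLp (g : L2T)).star.mul' hθ.1.1
  refine fourierCoeff_mul_eq_zero (a := 0) (b := 1) hkg hθg ?_ hg (by norm_num)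
  exact fun n hn => fourierCoeff_mul_eq_zero (a := 0) (b := 0) hk.memLp_two
    (Lp.memLp (g : L2T)) hk.2 g.2 (by simpa using hn)

end ModelSpace

/-! ### The Frostman shift and the Crofoot multiplier -/

section Crofoot

variable {θ : Torus → ℂ} {l : ℂ}

/-- The numerator of `θ_l` is, for unimodular `θ`, the product of `θ` and the conjugate of the
denominator. -/
theorem thetaShift_mul_one_sub_conj {t : Torus} (hc : ‖diskValue θ l‖ < 1) (ht : ‖θ t‖ = 1) :
    thetaShift θ l t * (1 - conj (diskValue θ l) * θ t) =
      θ t * (1 - diskValue θ l * conj (θ t)) := by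
  rw [thetaShift, div_mul_cancel₀ _ (one_sub_mul_ne_zero (by simpa using hc) ht)]
  linear_combination (diskValue θ l) * mul_conj_eq_one ht

theorem thetaShift_eq_blaschke_mul (hl : ‖l‖ < 1) (t : Torus) :
    thetaShift θ l t = blaschke l t * (conjKernelFun θ l t / kernelFun θ l t) := by
  have h1 : 1 - conj l * zCoord t ≠ 0 :=
    one_sub_mul_ne_zero (by simpa using hl) (norm_zCoord t)
  have h2 : zCoord t - l ≠ 0 := by
    intro h
    rw [sub_eq_zero] at h
    rw [← h, norm_zCoord] at hl
    exact lt_irrefl _ hl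
  rw [thetaShift, blaschke, conjKernelFun, kernelFun, div_div_div_eq, div_mul_div_comm,
    mul_comm (θ t - diskValue θ l), ← mul_assoc, mul_comm (zCoord t - l), ← mul_assoc,
    mul_div_mul_left _ _ (by exact mul_ne_zero h1 h2)]

theorem IsInner.thetaShift (hθ : IsInner θ) (hc : ‖diskValue θ l‖ < 1) :
    IsInner (thetaShift θ l) := by
  refine ⟨?_, ?_⟩
  · have h1 := (hθ.1.add (memHInf_const (-diskValue θ l))).mul
      (hθ.memHInf_inv_one_sub_const_mul (a := conj (diskValue θ l)) (by simpa using hc))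
    refine h1.congr_ae (Eventually.of_forall fun t => ?_)
    simp only [_root_.thetaShift, div_eq_mul_inv, sub_eq_add_neg]
  · filter_upwards [hθ.2] with t ht
    have h := congrArg norm (thetaShift_mul_one_sub_conj hc ht)
    have hne := one_sub_mul_ne_zero (a := conj (diskValue θ l)) (by simpa using hc) ht
    have hconj : 1 - diskValue θ l * conj (θ t) = conj (1 - conj (diskValue θ l) * θ t) := by
      simp
    rw [norm_mul, norm_mul, ht, one_mul, hconj, RCLike.norm_conj] at h
    exact mul_right_cancel₀ (norm_ne_zero_iff.2 hne) (h.trans (one_mul _).symm)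

theorem IsInner.isUnitHInf_one_sub_const_mul (hθ : IsInner θ) {a : ℂ} (ha : ‖a‖ < 1) :
    IsUnitHInf (fun t => 1 - a * θ t) := by
  refine ⟨hθ.1.one_sub_const_mul a, _, hθ.memHInf_inv_one_sub_const_mul ha, ?_⟩
  filter_upwards [hθ.2] with t ht
  exact mul_inv_cancel₀ (one_sub_mul_ne_zero ha ht)

theorem IsUnitHInf.inv {f : Torus → ℂ} (hf : IsUnitHInf f) : IsUnitHInf (fun t => (f t)⁻¹) := by
  obtain ⟨hf, k, hk, hfk⟩ := hf
  have hk' : k =ᵐ[arcMeasure] fun t => (f t)⁻¹ := by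
    filter_upwards [hfk] with t ht
    exact eq_inv_of_mul_eq_one_right ht
  refine ⟨hk.congr_ae hk', f, hf, ?_⟩
  filter_upwards [hfk] with t ht
  exact inv_mul_cancel₀ (left_ne_zero_of_mul_eq_one ht)

theorem IsUnitHInf.div_const {f : Torus → ℂ} (hf : IsUnitHInf f) {c : ℂ} (hc : c ≠ 0) :
    IsUnitHInf (fun t => f t / c) := by
  obtain ⟨hf, k, hk, hfk⟩ := hf
  refine ⟨?_, _, hk.const_mul c, ?_⟩
  · simpa only [div_eq_inv_mul] using hf.const_mul c⁻¹
  · filter_upwards [hfk] with t ht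
    rw [← mul_assoc, div_mul_cancel₀ _ hc, ht]

/-- `θ = (1 - c conj θ)⁻¹ θ_l (1 - (conj c) θ)`, with `c = θ (l)`. -/
theorem IsInner.boundedFactorization_thetaShift (hθ : IsInner θ) (hc : ‖diskValue θ l‖ < 1) :
    BoundedFactorization θ (_root_.thetaShift θ l) 1 := by
  have hc' : ‖conj (diskValue θ l)‖ < 1 := by simpa using hc
  refine ⟨hθ.thetaShift hc, fun t => (1 - diskValue θ l * conj (θ t))⁻¹,
    fun t => 1 - conj (diskValue θ l) * θ t, hθ.isUnitHInf_one_sub_const_mul hc', ?_, ?_⟩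
  · simpa using (hθ.isUnitHInf_one_sub_const_mul hc').inv
  · filter_upwards [hθ.2] with t ht
    rw [zpow_one, mul_assoc, thetaShift_mul_one_sub_conj hc ht, mul_left_comm,
      inv_mul_cancel₀ (one_sub_mul_ne_zero hc (by simpa using ht)), mul_one]

theorem sqrt_one_sub_sq_ne_zero {c : ℂ} (hc : ‖c‖ < 1) :
    ((Real.sqrt (1 - ‖c‖ ^ 2) : ℝ) : ℂ) ≠ 0 := by
  rw [Complex.ofReal_ne_zero, Real.sqrt_ne_zero']
  nlinarith [norm_nonneg c]

theorem IsInner.isUnitHInf_crofootMultiplier (hθ : IsInner θ) (hc : ‖diskValue θ l‖ < 1) :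
    IsUnitHInf (crofootMultiplier θ l) :=
  (hθ.isUnitHInf_one_sub_const_mul (by simpa using hc)).div_const (sqrt_one_sub_sq_ne_zero hc)

theorem mul_conj_crofootMultiplier {t : Torus} (hc : ‖diskValue θ l‖ < 1) (ht : ‖θ t‖ = 1) :
    θ t * conj (crofootMultiplier θ l t) = crofootMultiplier θ l t * thetaShift θ l t := by
  have h := thetaShift_mul_one_sub_conj hc ht
  simp only [crofootMultiplier, map_div₀, map_sub, map_one, map_mul, Complex.conj_conj,
    Complex.conj_ofReal]
  rw [div_mul_eq_mul_div, mul_comm _ (thetaShift θ l t), h, mul_div_assoc]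

/-- The pointwise identity `|f|² = |g|² + w + conj w` for `g = M f`. With `c = θ (l)`, it says that
`|M|⁻²`, which is the Poisson kernel `(1 - |c|²) / |1 - (conj c) θ|²`, is `1 + 2 Re v`,
where `v = (conj c) θ / (1 - (conj c) θ)`. -/
theorem mul_conj_eq_crofootMultiplier {t : Torus} (hc : ‖diskValue θ l‖ < 1) (ht : ‖θ t‖ = 1)
    {f g w : ℂ} (hg : g = crofootMultiplier θ l t * f)
    (hw : w = conj (diskValue θ l) * (1 - conj (diskValue θ l) * θ t)⁻¹ * g * (θ t * conj g)) :
    conj f * f = conj g * g + (w + conj w) := by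
  have h1 := one_sub_mul_ne_zero (a := conj (diskValue θ l)) (by simpa using hc) ht
  have h2 : 1 - diskValue θ l * conj (θ t) ≠ 0 := one_sub_mul_ne_zero hc (by simpa using ht)
  have hs := sqrt_one_sub_sq_ne_zero hc
  have hθ := mul_conj_eq_one ht
  have hs2 : ((Real.sqrt (1 - ‖diskValue θ l‖ ^ 2) : ℝ) : ℂ) ^ 2 =
      1 - diskValue θ l * conj (diskValue θ l) := by
    rw [← Complex.ofReal_pow, Real.sq_sqrt (by nlinarith [norm_nonneg (diskValue θ l)]),
      Complex.mul_conj, Complex.normSq_eq_norm_sq]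
    push_cast; rfl
  set c := diskValue θ l
  set s : ℂ := ((Real.sqrt (1 - ‖c‖ ^ 2) : ℝ) : ℂ) with hsdef
  have hf : f = s * g / (1 - conj c * θ t) := by
    have hg' : g = (1 - conj c * θ t) / s * f := hg
    rw [hg']
    field_simp
  have hsc : conj s = s := Complex.conj_ofReal _
  rw [hw, hf]
  simp only [map_mul, map_div₀, map_sub, map_one, map_inv₀, Complex.conj_conj, hsc]
  field_simp
  rw [hs2]
  linear_combination (c * conj c * conj g * g) * hθ

/-- The multiplier `M` is isometric on `K_{θ_l}`: for `g = M f ∈ K_θ`, the difference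
`|f|² - |g|² = 2 Re (k θ |g|²)`, with `k = conj c / (1 - (conj c) θ) ∈ H^∞` and `c = θ (l)`, has
mean zero. -/
theorem norm_modelSpaceMul_crofootMultiplier (hθ : IsInner θ) (hc : ‖diskValue θ l‖ < 1)
    (hin : IsInner (thetaShift θ l))
    (h : ∀ᵐ t ∂arcMeasure,
      θ t * conj (crofootMultiplier θ l t) = crofootMultiplier θ l t * thetaShift θ l t)
    (f : modelSpace (thetaShift θ l) hin) :
    ‖modelSpaceMul hin hθ (hθ.isUnitHInf_crofootMultiplier hc).1 h f‖ = ‖f‖ := by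
  set g := modelSpaceMul hin hθ (hθ.isUnitHInf_crofootMultiplier hc).1 h f with hgdef
  have hk : MemHInf (fun t => conj (diskValue θ l) * (1 - conj (diskValue θ l) * θ t)⁻¹) :=
    (hθ.memHInf_inv_one_sub_const_mul (by simpa using hc)).const_mul _
  set w : Torus → ℂ := fun t => conj (diskValue θ l) * (1 - conj (diskValue θ l) * θ t)⁻¹ *
    ((g : H2) : L2T) t * (θ t * conj (((g : H2) : L2T) t)) with hw
  have hw0 : ∫ t, w t ∂arcMeasure = 0 := integral_mul_mul_conj_eq_zero hθ hk g.2
  have hwint : Integrable w arcMeasure := by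
    have h1 : MemLp (fun t => conj (diskValue θ l) * (1 - conj (diskValue θ l) * θ t)⁻¹ *
        ((g : H2) : L2T) t) 2 arcMeasure := (Lp.memLp ((g : H2) : L2T)).mul' hk.1
    have h2 : MemLp (fun t => θ t * conj (((g : H2) : L2T) t)) 2 arcMeasure :=
      (Lp.memLp ((g : H2) : L2T)).star.mul' hθ.1.1
    exact h1.integrable_mul h2
  have hwc : Integrable (fun t => conj (w t)) arcMeasure := by
    simpa using (LinearIsometryEquiv.integrable_comp_iff Complex.conjLIE).2 hwint
  have hgg : Integrable (fun t => conj (((g : H2) : L2T) t) * ((g : H2) : L2T) t) arcMeasure :=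
    (Lp.memLp ((g : H2) : L2T)).star.integrable_mul (Lp.memLp ((g : H2) : L2T))
  have key : (inner ℂ ((f : H2) : L2T) ((f : H2) : L2T) : ℂ) =
      inner ℂ ((g : H2) : L2T) ((g : H2) : L2T) := by
    rw [inner_eq_integral_conj_mul, inner_eq_integral_conj_mul]
    have hae : ∀ᵐ t ∂arcMeasure, conj (((f : H2) : L2T) t) * ((f : H2) : L2T) t =
        conj (((g : H2) : L2T) t) * ((g : H2) : L2T) t + (w t + conj (w t)) := by
      filter_upwards [hθ.2, coeFn_modelSpaceMul hin hθ (hθ.isUnitHInf_crofootMultiplier hc).1 h f]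
        with t ht h1
      exact mul_conj_eq_crofootMultiplier hc ht h1 rfl
    have hww : Integrable (fun t => w t + conj (w t)) arcMeasure := hwint.add hwc
    rw [integral_congr_ae hae, integral_add hgg hww, integral_add hwint hwc, integral_conj, hw0,
      map_zero, add_zero, add_zero]
  rw [inner_self_eq_norm_sq_to_K, inner_self_eq_norm_sq_to_K] at key
  have key' : ‖((f : H2) : L2T)‖ ^ 2 = ‖((g : H2) : L2T)‖ ^ 2 := by exact_mod_cast key
  exact ((pow_left_inj₀ (norm_nonneg _) (norm_nonneg _) two_ne_zero).1 key').symm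

end Crofoot

theorem mainTheorem12 (θ : Torus → ℂ) (hθ : IsInner θ)
    (hnc : ¬ ∃ c : ℂ, ∀ᵐ t ∂arcMeasure, θ t = c) (l : ℂ) (hl : ‖l‖ < 1) :
    (∀ᵐ t ∂arcMeasure,
      thetaShift θ l t = blaschke l t * (conjKernelFun θ l t / kernelFun θ l t)) ∧
    ∃ hin : IsInner (thetaShift θ l),
      BoundedFactorization θ (thetaShift θ l) 1 ∧
      IsUnitHInf (crofootMultiplier θ l) ∧
      ∃ U : modelSpace (thetaShift θ l) hin ≃ₗᵢ[ℂ] modelSpace θ hθ,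
        ∀ f : modelSpace (thetaShift θ l) hin,
          ∀ᵐ t ∂arcMeasure,
            ((U f : H2) : L2T) t = crofootMultiplier θ l t * ((f : H2) : L2T) t := by
  have hc := hθ.norm_diskValue_lt_one hnc hl
  have hin := hθ.thetaShift hc
  have hM := hθ.isUnitHInf_crofootMultiplier hc
  have h : ∀ᵐ t ∂arcMeasure,
      θ t * conj (crofootMultiplier θ l t) = crofootMultiplier θ l t * thetaShift θ l t := by
    filter_upwards [hθ.2] with t ht
    exact mul_conj_crofootMultiplier hc ht
  refine ⟨Eventually.of_forall fun t => thetaShift_eq_blaschke_mul hl t, hin,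
    hθ.boundedFactorization_thetaShift hc, hM, ?_⟩
  obtain ⟨N, hN, hMN⟩ := hM.2
  -- The intertwining relation of `M` passes to its inverse `N`, which thus maps back.
  have h' : ∀ᵐ t ∂arcMeasure, thetaShift θ l t * conj (N t) = N t * θ t := by
    filter_upwards [h, hMN] with t h1 h2
    have h3 : conj (crofootMultiplier θ l t) * conj (N t) = 1 := by rw [← map_mul, h2, map_one]
    linear_combination (-(N t * conj (N t))) * h1 - (thetaShift θ l t * conj (N t)) * h2 +
      N t * θ t * h3
  let e : modelSpace (thetaShift θ l) hin ≃ₗ[ℂ] modelSpace θ hθ :=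
    { modelSpaceMul hin hθ hM.1 h with
      invFun := modelSpaceMul hθ hin hN h'
      left_inv := modelSpaceMul_modelSpaceMul hin hθ hM.1 h hN h'
        (by simpa only [mul_comm] using hMN)
      right_inv := modelSpaceMul_modelSpaceMul hθ hin hN h' hM.1 h hMN }
  exact ⟨⟨e, norm_modelSpaceMul_crofootMultiplier hθ hc hin h⟩,
    coeFn_modelSpaceMul hin hθ hM.1 h⟩
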